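/- Let $\mathbb{F}$ be a field of characteristic $0$ and let $m \ge 0$ be an integer. For $n\ge 1$ let $R(n,m)$ be the ring of matrix semi-invariants, i.e. the $\mathbb{F}$-algebra of those polynomials $f \in \mathbb{F}[x^{(k)}_{i,j} : 1\le k\le m,\ 1\le i,j\le n]$ in the entries of $m$ generic $n\times n$ matrices $X_k=(x^{(k)}_{i,j})_{i,j}$ such that $f(AX_1C^{-1},\dots,AX_mC^{-1}) = f(X_1,\dots,X_m)$ for all $(A,C)\in \mathrm{SL}(n,\mathbb{F})\times \mathrm{SL}(n,\mathbb{F})$. Let $\beta(R(n,m))$ be the smallest integer $D\geq 0$ such that the elements of $R(n,m)$ of degree $\le D$ generate $R(n,m)$ as an $\mathbb{F}$-algebra (and $\infty$ if there is no such $D$). Then $R(2,m)$ is generated as an $\mathbb{F}$-algebra by its elements of degree $\le 4$; that is, $\beta(R(2,m))\le 4$. -/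

import Mathlib

namespace MatrixSemiInvariants

/-- The coordinate ring `F[x_{i,j}^{(k)}]` of the space of `m`-tuples of `n × n` matrices over `F`;
the variable `x_{i,j}^{(k)}` is `X (k, i, j)`. -/
abbrev CoordRing (F : Type*) [Field F] (n m : ℕ) : Type _ :=
  MvPolynomial (Fin m × Fin n × Fin n) F

/-- The `k`-th generic matrix `X_k = (x_{i,j}^{(k)})_{i,j}`. -/
noncomputable def genericMatrix (F : Type*) [Field F] (n m : ℕ) (k : Fin m) :
    Matrix (Fin n) (Fin n) (CoordRing F n m) :=
  Matrix.of fun i j => MvPolynomial.X (k, i, j)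

/-- A matrix over `F`, viewed as a matrix of constant polynomials. -/
noncomputable def constMatrix {F : Type*} [Field F] {n : ℕ} (m : ℕ)
    (A : Matrix.SpecialLinearGroup (Fin n) F) : Matrix (Fin n) (Fin n) (CoordRing F n m) :=
  A.1.map MvPolynomial.C

/-- The substitution `f(X_1, …, X_m) ↦ f(A X_1 C⁻¹, …, A X_m C⁻¹)` on polynomials. -/
noncomputable def subst {F : Type*} [Field F] {n : ℕ} (m : ℕ)
    (A C : Matrix.SpecialLinearGroup (Fin n) F) : CoordRing F n m →ₐ[F] CoordRing F n m :=
  MvPolynomial.aeval fun p : Fin m × Fin n × Fin n =>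
    (constMatrix m A * genericMatrix F n m p.1 * constMatrix m C⁻¹) p.2.1 p.2.2

/-- The ring `R(n, m)` of matrix semi-invariants: the polynomials on `m`-tuples of `n × n` matrices
that are invariant under `(B_1, …, B_m) ↦ (A B_1 C⁻¹, …, A B_m C⁻¹)` for all
`(A, C) ∈ SL(n, F) × SL(n, F)`. -/
noncomputable def R (F : Type*) [Field F] (n m : ℕ) : Subalgebra F (CoordRing F n m) where
  carrier := {f | ∀ A C : Matrix.SpecialLinearGroup (Fin n) F, subst m A C f = f}
  mul_mem' hf hg A C := by rw [map_mul, hf A C, hg A C]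
  add_mem' hf hg A C := by rw [map_add, hf A C, hg A C]
  algebraMap_mem' r A C := (subst m A C).commutes r

/-- The matrix semi-invariants of degree at most `D` generate `R(n, m)` as an `F`-algebra. -/
def GeneratedInDegreeLE (F : Type*) [Field F] (n m D : ℕ) : Prop :=
  Algebra.adjoin F {f : CoordRing F n m | f ∈ R F n m ∧ f.totalDegree ≤ D} = R F n m

/-- `β(R(n, m))`: the smallest `D` such that the matrix semi-invariants of degree at most `D`
generate `R(n, m)` (and `⊤` if there were no such `D`). -/
noncomputable def beta (F : Type*) [Field F] (n m : ℕ) : ℕ∞ :=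
  sInf ((fun D : ℕ => (D : ℕ∞)) '' {D : ℕ | GeneratedInDegreeLE F n m D})

end MatrixSemiInvariants

/-! The argument runs Cayley's Omega process twice, once for each factor of `SL₂ × SL₂`. Let `f` be
a homogeneous semi-invariant and `h` a generic `2 × 2` matrix. By invariance, `f(hᵀ X)` and `f(X h)`
are both `f` times a power of `det h` (`eq_C_mul_genDet_pow`). In characteristic 0, repeated
application of Omega strips off that power up to a nonzero scalar. So `f` lies in any algebra of
polynomials in `h` that contains the substituted form and is stable under Omega; setting `h = 0`
then reads off what `f` is made of.

On the left this writes `f` in the `2 × 2` minors of the columns of the `X_k`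
(`mem_adjoin_bracketSet`). On the right each minor becomes an entry of `hᵀ J adj(X_k) X_l h`. Omega
glues such chains into chains of products, or closes them into traces (`polar_chain`,
`cayley_chain`). The degree stops at 4 because products of two matrices `adj(X_k) X_l` reduce to
linear combinations of `1` and such matrices, with coefficients generated by traces of degree 2 and
4 (`mul_mem_evenSpan`). -/

namespace MatrixSemiInvariants
open MvPolynomial

/-! ### Cayley's Omega operator and algebras stable under it -/

section Omega

variable {A : Type*} [CommRing A]

/-- Polynomials in the entries of a generic `2 × 2` matrix `h`. -/
abbrev MatPoly (A : Type*) [CommRing A] : Type _ := MvPolynomial (Fin 2 × Fin 2) A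

/-- Cayley's Omega operator `∂₀₀ ∂₁₁ - ∂₀₁ ∂₁₀`. -/
noncomputable def cayley (P : MatPoly A) : MatPoly A :=
  pderiv (0, 0) (pderiv (1, 1) P) - pderiv (0, 1) (pderiv (1, 0) P)

/-- The polarization of the symbol of Cayley's operator. -/
noncomputable def polar (P Q : MatPoly A) : MatPoly A :=
  pderiv (0, 0) P * pderiv (1, 1) Q + pderiv (1, 1) P * pderiv (0, 0) Q
    - pderiv (0, 1) P * pderiv (1, 0) Q - pderiv (1, 0) P * pderiv (0, 1) Q

/-- The determinant of the generic `2 × 2` matrix. -/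
noncomputable def genDet (A : Type*) [CommRing A] : MatPoly A :=
  X (0, 0) * X (1, 1) - X (0, 1) * X (1, 0)

lemma cayley_add (P Q : MatPoly A) : cayley (P + Q) = cayley P + cayley Q := by
  simp only [cayley, map_add]; ring

lemma cayley_mul (P Q : MatPoly A) :
    cayley (P * Q) = cayley P * Q + P * cayley Q + polar P Q := by
  simp only [cayley, polar, Derivation.leibniz, map_add, smul_eq_mul]; ring

lemma cayley_C (a : A) : cayley (C a) = 0 := by simp [cayley]

lemma polar_comm (P Q : MatPoly A) : polar P Q = polar Q P := by simp only [polar]; ring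

lemma polar_C (a : A) (Q : MatPoly A) : polar (C a) Q = 0 := by simp [polar]

lemma polar_add (P Q T : MatPoly A) : polar (P + Q) T = polar P T + polar Q T := by
  simp only [polar, map_add]; ring

lemma polar_mul (P Q T : MatPoly A) : polar (P * Q) T = P * polar Q T + Q * polar P T := by
  simp only [polar, Derivation.leibniz, smul_eq_mul]; ring

lemma cayley_C_mul (a : A) (P : MatPoly A) : cayley (C a * P) = C a * cayley P := by
  rw [cayley_mul, cayley_C, polar_C]; ring

lemma cayley_genDet_pow (d : ℕ) :
    cayley (genDet A ^ (d + 1)) = C (((d + 1) * (d + 2) : ℕ) : A) * genDet A ^ d := by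
  have h00 : pderiv (0, 0) (genDet A) = X (1, 1) := by
    simp [genDet, pderiv_X]
  have h11 : pderiv (1, 1) (genDet A) = X (0, 0) := by
    simp [genDet, pderiv_X]
  have h01 : pderiv (0, 1) (genDet A) = - X (1, 0) := by
    simp [genDet, pderiv_X]
  have h10 : pderiv (1, 0) (genDet A) = - X (0, 1) := by
    simp [genDet, pderiv_X]
  have key : cayley (genDet A) = 2 := by
    simp only [cayley, h11, h10, map_neg, pderiv_X_self]; ring
  have hp : ∀ n : ℕ, polar (genDet A ^ n) (genDet A) = 2 * n * genDet A ^ n := by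
    intro n
    induction n with
    | zero => simpa using polar_C (1 : A) (genDet A)
    | succ n ih =>
      have : polar (genDet A) (genDet A) = 2 * genDet A := by
        simp only [polar, h00, h11, h10, h01]; rw [genDet]; ring
      rw [pow_succ, polar_mul, ih, this]; push_cast; ring
  induction d with
  | zero => simpa [key] using (map_ofNat C 2).symm
  | succ d ih =>
    rw [pow_succ, cayley_mul, ih, key, hp]
    simp only [map_natCast]; push_cast; ring

variable {F : Type*} [Field F] [Algebra F A]

/-- `polar` is a derivation in each argument, so closure need only be checked on generators. -/
lemma polar_mem_adjoin {G : Set (MatPoly A)}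
    (hG : ∀ g ∈ G, ∀ g' ∈ G, polar g g' ∈ Algebra.adjoin F G)
    {P Q : MatPoly A} (hP : P ∈ Algebra.adjoin F G) (hQ : Q ∈ Algebra.adjoin F G) :
    polar P Q ∈ Algebra.adjoin F G := by
  have halg : ∀ (r : F) (T : MatPoly A), polar (algebraMap F (MatPoly A) r) T = 0 := fun r T => by
    rw [MvPolynomial.algebraMap_apply, polar_C]
  have step : ∀ T, (∀ g ∈ G, polar g T ∈ Algebra.adjoin F G) →
      ∀ P ∈ Algebra.adjoin F G, polar P T ∈ Algebra.adjoin F G := by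
    intro T hT P hP
    induction hP using Algebra.adjoin_induction with
    | mem g hg => exact hT g hg
    | algebraMap r => rw [halg]; exact zero_mem _
    | add x y _ _ hx hy => rw [polar_add]; exact add_mem hx hy
    | mul x y hx' hy' hx hy =>
      rw [polar_mul]; exact add_mem (mul_mem hx' hy) (mul_mem hy' hx)
  refine step Q (fun g hg => ?_) P hP
  rw [polar_comm]
  exact step g (fun g' hg' => hG g' hg' g hg) Q hQ

/-- Omega has order two: its failure to be a derivation is exactly `polar`, so stability reduces to
generators and pairs of generators. -/
lemma cayley_mem_adjoin {G : Set (MatPoly A)}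
    (hG : ∀ g ∈ G, cayley g ∈ Algebra.adjoin F G)
    (hG₂ : ∀ g ∈ G, ∀ g' ∈ G, polar g g' ∈ Algebra.adjoin F G)
    {P : MatPoly A} (hP : P ∈ Algebra.adjoin F G) : cayley P ∈ Algebra.adjoin F G := by
  induction hP using Algebra.adjoin_induction with
  | mem g hg => exact hG g hg
  | algebraMap r => rw [MvPolynomial.algebraMap_apply, cayley_C]; exact zero_mem _
  | add x y _ _ hx hy => rw [cayley_add]; exact add_mem hx hy
  | mul x y hx' hy' hx hy =>
    rw [cayley_mul]
    exact add_mem (add_mem (mul_mem hx hy') (mul_mem hx' hy)) (polar_mem_adjoin hG₂ hx' hy')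

/-- Each application of Omega lowers the power of the determinant by one, at the cost of a factor
`(d + 1)(d + 2)` invertible in characteristic 0. -/
lemma C_mem_of_genDet_pow_mul_mem [CharZero F] {T : Subalgebra F (MatPoly A)}
    (hT : ∀ P ∈ T, cayley P ∈ T) (a : A) (d : ℕ) (h : C a * genDet A ^ d ∈ T) : C a ∈ T := by
  induction d with
  | zero => simpa using h
  | succ d ih =>
    apply ih
    have h1 := hT _ h
    rw [cayley_C_mul, cayley_genDet_pow] at h1
    have hne : (((d + 1) * (d + 2) : ℕ) : F) ≠ 0 := by
      exact_mod_cast (by positivity : (d + 1) * (d + 2) ≠ 0)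
    have h2 := T.smul_mem h1 (((d + 1) * (d + 2) : ℕ) : F)⁻¹
    have e : C a * (C (((d + 1) * (d + 2) : ℕ) : A) * genDet A ^ d)
        = (((d + 1) * (d + 2) : ℕ) : F) • (C a * genDet A ^ d) := by
      rw [Algebra.smul_def, map_natCast, map_natCast]; ring
    rwa [e, smul_smul, inv_mul_cancel₀ hne, one_smul] at h2

end Omega

/-! ### Invariant polynomials in `h` are multiples of powers of `det h` -/

section Equivariance

variable {F A : Type*} [Field F] [CommRing A] [Algebra F A]

/-- Evaluation of the generic matrix at a matrix with entries in the base field. -/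
noncomputable def evalMat (h : Matrix (Fin 2) (Fin 2) F) : MatPoly A →ₐ[A] A :=
  aeval fun p => algebraMap F A (h p.1 p.2)

lemma evalMat_genDet (h : Matrix (Fin 2) (Fin 2) F) :
    evalMat h (genDet A) = algebraMap F A h.det := by
  simp [evalMat, genDet, Matrix.det_fin_two]

lemma evalMat_C (h : Matrix (Fin 2) (Fin 2) F) (a : A) : evalMat h (C a) = a := by
  simp [evalMat]

/-- A homogeneous `SL₂`-invariant polynomial in the entries of the generic matrix is a multiple of
a power of the determinant. -/
lemma eq_C_mul_genDet_pow [CharZero F] [IsDomain A] (P : MatPoly A) (a : A) (n : ℕ)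
    (hinv : ∀ (h : Matrix (Fin 2) (Fin 2) F) (s : Matrix.SpecialLinearGroup (Fin 2) F),
      evalMat (h * s.1) P = evalMat h P)
    (hscale : ∀ t : F, evalMat (t • (1 : Matrix (Fin 2) (Fin 2) F)) P = algebraMap F A (t ^ n) * a) :
    ∃ d, P = C a * genDet A ^ d := by
  have hinj : Function.Injective (algebraMap F A) := (algebraMap F A).injective
  -- `q` restricts `P` to the matrices `diag(δ, 1)`, which represent all nonzero determinants modulo
  -- `SL₂`.
  let q : Polynomial A := aeval (fun p : Fin 2 × Fin 2 =>
    (!![Polynomial.X, 0; 0, 1] : Matrix (Fin 2) (Fin 2) (Polynomial A)) p.1 p.2) P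
  have hq : ∀ δ : F, q.eval (algebraMap F A δ) = evalMat (!![δ, 0; 0, 1]) P := by
    intro δ
    have : (Polynomial.aeval (algebraMap F A δ)).comp (aeval (fun p : Fin 2 × Fin 2 =>
        (!![Polynomial.X, 0; 0, 1] : Matrix (Fin 2) (Fin 2) (Polynomial A)) p.1 p.2))
        = (evalMat (!![δ, 0; 0, 1]) : MatPoly A →ₐ[A] A) := by
      apply MvPolynomial.algHom_ext
      rintro ⟨i, j⟩
      fin_cases i <;> fin_cases j <;> simp [evalMat]
    rw [← this, AlgHom.comp_apply, Polynomial.coe_aeval_eq_eval]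
  have hsq : ∀ t : F, t ≠ 0 →
      q.eval (algebraMap F A (t ^ 2)) = algebraMap F A (t ^ n) * a := by
    intro t ht
    -- `diag(t², 1) = t · diag(t, t⁻¹)`, and the second factor lies in `SL₂`.
    rw [hq, ← hscale, ← hinv (t • 1) ⟨!![t, 0; 0, t⁻¹], by simp [Matrix.det_fin_two, ht]⟩]
    congr 2
    ext i j
    fin_cases i <;> fin_cases j <;> simp [ht, pow_two]
  have hexp : Polynomial.expand A 2 q = Polynomial.C a * Polynomial.X ^ n := by
    apply Polynomial.eq_of_infinite_eval_eq
    refine Set.Infinite.mono (s := algebraMap F A '' {0}ᶜ) ?_ ?_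
    · rintro _ ⟨t, ht, rfl⟩
      simp only [Set.mem_ofPred_eq, Polynomial.expand_eval, Polynomial.eval_mul, Polynomial.eval_C,
        Polynomial.eval_pow, Polynomial.eval_X]
      rw [← map_pow, hsq t ht, map_pow, mul_comm]
    · exact (Set.finite_singleton (0 : F)).infinite_compl.image hinj.injOn
  have hgen : ∃ d, ∀ δ : F, q.eval (algebraMap F A δ) = a * algebraMap F A (δ ^ d) := by
    rcases Nat.even_or_odd n with ⟨d, rfl⟩ | hn
    · refine ⟨d, fun δ => ?_⟩
      have : q = Polynomial.C a * Polynomial.X ^ d := by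
        apply Polynomial.expand_injective (R := A) (n := 2) (by norm_num)
        rw [hexp, map_mul, map_pow, Polynomial.expand_C, Polynomial.expand_X]; ring
      rw [this]; simp
    -- `q(X²)` has no odd-degree terms, so odd `n` forces `a = 0`.
    · have ha : a = 0 := by
        have h1 := congrArg (fun p => p.coeff n) hexp
        have h2 : ¬ 2 ∣ n := by rw [← even_iff_two_dvd]; exact Nat.not_even_iff_odd.2 hn
        simpa [Polynomial.coeff_expand (show 0 < 2 by norm_num), h2] using h1.symm
      refine ⟨0, fun δ => ?_⟩
      have : q = 0 := by
        apply Polynomial.expand_injective (R := A) (n := 2) (by norm_num)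
        rw [hexp, ha]; simp
      simp [this, ha]
  obtain ⟨d, hd⟩ := hgen
  refine ⟨d, ?_⟩
  -- The extra determinant factor makes singular matrices harmless; testing at points over `F`
  -- suffices since `F` is infinite.
  have hzero : genDet A * (P - C a * genDet A ^ d) = 0 := by
    apply MvPolynomial.funext_set (fun _ => Set.range (algebraMap F A))
      (fun _ => Set.infinite_range_of_injective hinj)
    intro x hx
    choose y hy using fun i => hx i (Set.mem_univ i)
    let h : Matrix (Fin 2) (Fin 2) F := Matrix.of fun i j => y (i, j)
    have hev : ∀ Q : MatPoly A, eval x Q = evalMat h Q := by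
      intro Q
      have : x = fun p => algebraMap F A (h p.1 p.2) := by ext p; exact (hy p).symm
      rw [evalMat, this, ← MvPolynomial.coe_aeval_eq_eval]; rfl
    rw [hev, hev, map_mul, map_zero, map_sub, map_mul, map_pow, evalMat_genDet, evalMat_C]
    by_cases h0 : h.det = 0
    · simp [h0]
    · have : h = !![h.det, 0; 0, 1] *
          ((!![(h.det)⁻¹, 0; 0, 1] * h : Matrix (Fin 2) (Fin 2) F)) := by
        rw [← Matrix.mul_assoc]
        conv_lhs => rw [← Matrix.one_mul h]
        congr 1
        ext i j
        fin_cases i <;> fin_cases j <;> simp [h0]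
      have hP : evalMat h P = evalMat (!![h.det, 0; 0, 1]) P := by
        rw [this, hinv _ ⟨!![(h.det)⁻¹, 0; 0, 1] * h, by
          rw [Matrix.det_mul]; simp [Matrix.det_fin_two_of, h0]⟩, ← this]
      rw [hP, ← hq, hd, map_pow]; ring
  have hdet : genDet A ≠ 0 := by
    intro h0
    have := congrArg (evalMat (1 : Matrix (Fin 2) (Fin 2) F)) h0
    rw [evalMat_genDet] at this
    simp at this
  exact sub_eq_zero.1 ((mul_eq_zero.1 hzero).resolve_left hdet)

lemma C_mem_of_invariant [CharZero F] [IsDomain A] {G : Set (MatPoly A)}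
    (hG : ∀ g ∈ G, cayley g ∈ Algebra.adjoin F G)
    (hG₂ : ∀ g ∈ G, ∀ g' ∈ G, polar g g' ∈ Algebra.adjoin F G)
    {P : MatPoly A} (hP : P ∈ Algebra.adjoin F G) (a : A) (n : ℕ)
    (hinv : ∀ (h : Matrix (Fin 2) (Fin 2) F) (s : Matrix.SpecialLinearGroup (Fin 2) F),
      evalMat (h * s.1) P = evalMat h P)
    (hscale : ∀ t : F, evalMat (t • (1 : Matrix (Fin 2) (Fin 2) F)) P = algebraMap F A (t ^ n) * a) :
    C a ∈ Algebra.adjoin F G := by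
  obtain ⟨d, rfl⟩ := eq_C_mul_genDet_pow P a n hinv hscale
  exact C_mem_of_genDet_pow_mul_mem (fun _ => cayley_mem_adjoin hG hG₂) a d hP

end Equivariance

/-! ### Omega on the forms `hᵀ J U h` -/

section Chains

variable {A : Type*} [CommRing A]

/-- The `(i, j)` entry of `hᵀ J U h`, where `h` is the generic matrix and
`J = !![0, 1; -1, 0]`. -/
noncomputable def chain (U : Matrix (Fin 2) (Fin 2) A) (i j : Fin 2) : MatPoly A :=
  X (0, i) * (C (U 1 0) * X (0, j) + C (U 1 1) * X (1, j))
    - X (1, i) * (C (U 0 0) * X (0, j) + C (U 0 1) * X (1, j))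

/-- The alternating sign on `Fin 2`. -/
def alt (i j : Fin 2) : ℤ := (!![0, 1; -1, 0] : Matrix (Fin 2) (Fin 2) ℤ) i j

lemma cayley_chain (U : Matrix (Fin 2) (Fin 2) A) (i j : Fin 2) :
    cayley (chain U i j) = C ((alt i j : A) * U.trace) := by
  fin_cases i <;> fin_cases j <;>
    simp [cayley, chain, alt, pderiv_X, Matrix.trace_fin_two, Derivation.leibniz] <;> ring

lemma pderiv_chain_zero (U : Matrix (Fin 2) (Fin 2) A) (i j r : Fin 2) :
    pderiv (0, r) (chain U i j) =
      (if i = r then C (U 1 0) * X (0, j) + C (U 1 1) * X (1, j) else 0) +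
      (if j = r then X (0, i) * C (U 1 0) - X (1, i) * C (U 0 0) else 0) := by
  by_cases hi : i = r <;> by_cases hj : j = r <;>
    simp [chain, pderiv_X, Derivation.leibniz, hi, hj] <;>
    ring

lemma pderiv_chain_one (U : Matrix (Fin 2) (Fin 2) A) (i j r : Fin 2) :
    pderiv (1, r) (chain U i j) =
      (if i = r then - (C (U 0 0) * X (0, j) + C (U 0 1) * X (1, j)) else 0) +
      (if j = r then X (0, i) * C (U 1 1) - X (1, i) * C (U 0 1) else 0) := by
  by_cases hi : i = r <;> by_cases hj : j = r <;>
    simp [chain, pderiv_X, Derivation.leibniz, hi, hj] <;>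
    ring

lemma adjugate_fin_two_entries (U : Matrix (Fin 2) (Fin 2) A) :
    U.adjugate 0 0 = U 1 1 ∧ U.adjugate 0 1 = - U 0 1 ∧ U.adjugate 1 0 = - U 1 0 ∧
      U.adjugate 1 1 = U 0 0 := by
  simp [Matrix.adjugate_fin_two]

/-- `polar` contracts one end of each chain, giving four gluings. Reading a chain backwards replaces
`U` by `-adj U`, which accounts for the adjugates and signs. -/
lemma polar_chain (U V : Matrix (Fin 2) (Fin 2) A) (i j i' j' : Fin 2) :
    polar (chain U i j) (chain V i' j') =
      alt i i' * chain (U.adjugate * V) j j' - alt i j' * chain (U.adjugate * V.adjugate) j i'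
        - alt j i' * chain (U * V) i j' + alt j j' * chain (U * V.adjugate) i i' := by
  obtain ⟨u1, u2, u3, u4⟩ := adjugate_fin_two_entries U
  obtain ⟨v1, v2, v3, v4⟩ := adjugate_fin_two_entries V
  simp only [polar, pderiv_chain_zero, pderiv_chain_one]
  simp only [chain, Matrix.mul_apply, Fin.sum_univ_two, u1, u2, u3, u4, v1, v2, v3, v4, map_add,
    map_mul, map_neg]
  revert i j i' j'
  simp only [Fin.forall_fin_two, alt]
  simp only [Matrix.of_apply, Matrix.cons_val', Matrix.cons_val_zero, Matrix.cons_val_one,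
    Matrix.cons_val_fin_one, if_true, if_false, zero_ne_one, one_ne_zero, Int.cast_zero,
    Int.cast_one, Int.cast_neg, zero_mul, one_mul, neg_mul, zero_add, add_zero]
  refine ⟨⟨⟨⟨?_, ?_⟩, ?_, ?_⟩, ⟨?_, ?_⟩, ?_, ?_⟩, ⟨⟨?_, ?_⟩, ?_, ?_⟩, ⟨?_, ?_⟩, ?_, ?_⟩ <;> ring

end Chains

/-! ### Reduction of even words and the Omega-stable algebra of chains -/

section Words

variable {A : Type*} [CommRing A]

/-- A Clifford identity for the quadratic space `(M₂, det)`: since `adj(P) Q + adj(Q) P` is the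
scalar `tr(adj(P) Q)`, a fourfold product is alternating modulo shorter words. In dimension four the
alternating part acts as a scalar, which the trace determines; the factor 2 is `tr 1`. -/
lemma adjugate_mul_mul_adjugate_mul (P Q T V : Matrix (Fin 2) (Fin 2) A) :
    (2 : A) • ((P.adjugate * Q) * (T.adjugate * V)) =
      (P.adjugate * Q).trace • (T.adjugate * V) - (P.adjugate * T).trace • (Q.adjugate * V)
      + (P.adjugate * V).trace • (Q.adjugate * T) + (Q.adjugate * T).trace • (P.adjugate * V)
      - (Q.adjugate * V).trace • (P.adjugate * T) + (T.adjugate * V).trace • (P.adjugate * Q)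
      + ((P.adjugate * Q * (T.adjugate * V)).trace - ((P.adjugate * Q).trace * (T.adjugate * V).trace
        - (P.adjugate * T).trace * (Q.adjugate * V).trace
        + (P.adjugate * V).trace * (Q.adjugate * T).trace)) • (1 : Matrix (Fin 2) (Fin 2) A) := by
  obtain ⟨p1, p2, p3, p4⟩ := adjugate_fin_two_entries P
  obtain ⟨q1, q2, q3, q4⟩ := adjugate_fin_two_entries Q
  obtain ⟨t1, t2, t3, t4⟩ := adjugate_fin_two_entries T
  simp only [← Matrix.ext_iff, Fin.forall_fin_two, Matrix.add_apply, Matrix.sub_apply,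
    Matrix.smul_apply, smul_eq_mul, Matrix.mul_apply, Fin.sum_univ_two, Matrix.trace_fin_two,
    p1, p2, p3, p4, q1, q2, q3, q4, t1, t2, t3, t4, Matrix.one_apply_eq, Matrix.one_apply_ne, ne_eq,
    zero_ne_one, one_ne_zero, not_false_eq_true]
  refine ⟨⟨?_, ?_⟩, ?_, ?_⟩ <;> ring

lemma adjugate_eq_trace_smul_sub (U : Matrix (Fin 2) (Fin 2) A) :
    U.adjugate = U.trace • (1 : Matrix (Fin 2) (Fin 2) A) - U := by
  ext i j
  fin_cases i <;> fin_cases j <;> simp [Matrix.adjugate_fin_two, Matrix.trace_fin_two]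

/-- The span over a subring `S` of the identity and the matrices `adj(Y k) * Y l`. -/
def evenSpan {F ι : Type*} [Field F] [Algebra F A] (S : Subalgebra F A)
    (Y : ι → Matrix (Fin 2) (Fin 2) A) : Submodule S (Matrix (Fin 2) (Fin 2) A) :=
  Submodule.span S (insert 1 (Set.range fun p : ι × ι => (Y p.1).adjugate * Y p.2))

variable {F ι : Type*} [Field F] [Algebra F A] {S : Subalgebra F A}
  {Y : ι → Matrix (Fin 2) (Fin 2) A}

lemma one_mem_evenSpan : (1 : Matrix (Fin 2) (Fin 2) A) ∈ evenSpan S Y :=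
  Submodule.subset_span (Set.mem_insert _ _)

lemma adjugate_mul_mem_evenSpan (k l : ι) : (Y k).adjugate * Y l ∈ evenSpan S Y :=
  Submodule.subset_span (Set.mem_insert_of_mem _ ⟨(k, l), rfl⟩)

lemma smul_mem_evenSpan {a : A} (ha : a ∈ S) {U : Matrix (Fin 2) (Fin 2) A}
    (hU : U ∈ evenSpan S Y) : a • U ∈ evenSpan S Y :=
  (evenSpan S Y).smul_mem (⟨a, ha⟩ : S) hU

lemma trace_mem_of_mem_evenSpan (h₂ : ∀ k l, ((Y k).adjugate * Y l).trace ∈ S)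
    {U : Matrix (Fin 2) (Fin 2) A} (hU : U ∈ evenSpan S Y) : U.trace ∈ S := by
  induction hU using Submodule.span_induction with
  | mem x hx =>
    rcases hx with rfl | ⟨⟨k, l⟩, rfl⟩
    · simp
    · exact h₂ k l
  | zero => simp
  | add x y _ _ hx hy => rw [Matrix.trace_add]; exact add_mem hx hy
  | smul a x _ hx => rw [Matrix.trace_smul]; exact mul_mem a.2 hx

lemma adjugate_mem_evenSpan (h₂ : ∀ k l, ((Y k).adjugate * Y l).trace ∈ S)
    {U : Matrix (Fin 2) (Fin 2) A} (hU : U ∈ evenSpan S Y) : U.adjugate ∈ evenSpan S Y := by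
  rw [adjugate_eq_trace_smul_sub]
  exact sub_mem (smul_mem_evenSpan (trace_mem_of_mem_evenSpan h₂ hU) one_mem_evenSpan) hU

lemma mul_mem_evenSpan [CharZero F] (h₂ : ∀ k l, ((Y k).adjugate * Y l).trace ∈ S)
    (h₄ : ∀ k l p q, ((Y k).adjugate * Y l * ((Y p).adjugate * Y q)).trace ∈ S)
    {U V : Matrix (Fin 2) (Fin 2) A} (hU : U ∈ evenSpan S Y) (hV : V ∈ evenSpan S Y) :
    U * V ∈ evenSpan S Y := by
  have gen : ∀ k l p q,
      (Y k).adjugate * Y l * ((Y p).adjugate * Y q) ∈ evenSpan S Y := by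
    intro k l p q
    have key : (2 : A) • ((Y k).adjugate * Y l * ((Y p).adjugate * Y q)) ∈ evenSpan S Y := by
      rw [adjugate_mul_mul_adjugate_mul]
      have m : ∀ a b c d, ((Y a).adjugate * Y b).trace • ((Y c).adjugate * Y d) ∈ evenSpan S Y :=
        fun a b c d => smul_mem_evenSpan (h₂ a b) (adjugate_mul_mem_evenSpan c d)
      refine add_mem (add_mem (sub_mem (add_mem (add_mem (sub_mem (m _ _ _ _) (m _ _ _ _))
        (m _ _ _ _)) (m _ _ _ _)) (m _ _ _ _)) (m _ _ _ _)) (smul_mem_evenSpan ?_ one_mem_evenSpan)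
      exact sub_mem (h₄ k l p q) (add_mem (sub_mem (mul_mem (h₂ _ _) (h₂ _ _))
        (mul_mem (h₂ _ _) (h₂ _ _))) (mul_mem (h₂ _ _) (h₂ _ _)))
    have h := smul_mem_evenSpan (S.algebraMap_mem (2 : F)⁻¹) key
    have e : algebraMap F A (2 : F)⁻¹ * 2 = 1 := by
      rw [← map_ofNat (algebraMap F A) 2, ← map_mul, inv_mul_cancel₀ two_ne_zero, map_one]
    rwa [smul_smul, e, one_smul] at h
  induction hU using Submodule.span_induction with
  | mem x hx =>
    rcases hx with rfl | ⟨⟨k, l⟩, rfl⟩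
    · rwa [one_mul]
    · induction hV using Submodule.span_induction with
      | mem y hy =>
        rcases hy with rfl | ⟨⟨p, q⟩, rfl⟩
        · rw [mul_one]; exact adjugate_mul_mem_evenSpan k l
        · exact gen k l p q
      | zero => rw [mul_zero]; exact zero_mem _
      | add y z _ _ hy hz => rw [mul_add]; exact add_mem hy hz
      | smul a y _ hy => rw [Matrix.mul_smul]; exact Submodule.smul_mem _ a hy
  | zero => rw [zero_mul]; exact zero_mem _
  | add x y _ _ hx hy => rw [add_mul]; exact add_mem hx hy
  | smul a x _ hx => rw [Matrix.smul_mul]; exact Submodule.smul_mem _ a hx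

/-- The generators of the algebra of polynomials in the chains and the scalars from `S`. -/
def chainSet (S : Subalgebra F A) (Y : ι → Matrix (Fin 2) (Fin 2) A) : Set (MatPoly A) :=
  {P | ∃ U ∈ evenSpan S Y, ∃ i j, P = chain U i j} ∪ C '' (S : Set A)

lemma cayley_mem_chainSet (h₂ : ∀ k l, ((Y k).adjugate * Y l).trace ∈ S) :
    ∀ g ∈ chainSet S Y, cayley g ∈ Algebra.adjoin F (chainSet S Y) := by
  rintro _ (⟨U, hU, i, j, rfl⟩ | ⟨a, ha, rfl⟩)
  · rw [cayley_chain]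
    exact Algebra.subset_adjoin (Or.inr ⟨_, mul_mem (intCast_mem S _)
      (trace_mem_of_mem_evenSpan h₂ hU), rfl⟩)
  · rw [cayley_C]; exact zero_mem _

lemma polar_mem_chainSet [CharZero F] (h₂ : ∀ k l, ((Y k).adjugate * Y l).trace ∈ S)
    (h₄ : ∀ k l p q, ((Y k).adjugate * Y l * ((Y p).adjugate * Y q)).trace ∈ S) :
    ∀ g ∈ chainSet S Y, ∀ g' ∈ chainSet S Y, polar g g' ∈ Algebra.adjoin F (chainSet S Y) := by
  rintro _ (⟨U, hU, i, j, rfl⟩ | ⟨a, ha, rfl⟩) g' hg'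
  · rcases hg' with ⟨V, hV, i', j', rfl⟩ | ⟨a, ha, rfl⟩
    · have m : ∀ (n : ℤ) {W : Matrix (Fin 2) (Fin 2) A} (_ : W ∈ evenSpan S Y) (p q : Fin 2),
          (n : MatPoly A) * chain W p q ∈ Algebra.adjoin F (chainSet S Y) := fun n W hW p q =>
        mul_mem (intCast_mem _ n) (Algebra.subset_adjoin (Or.inl ⟨W, hW, p, q, rfl⟩))
      have hU' := adjugate_mem_evenSpan h₂ hU
      have hV' := adjugate_mem_evenSpan h₂ hV
      rw [polar_chain]
      exact add_mem (sub_mem (sub_mem (m _ (mul_mem_evenSpan h₂ h₄ hU' hV) _ _)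
        (m _ (mul_mem_evenSpan h₂ h₄ hU' hV') _ _)) (m _ (mul_mem_evenSpan h₂ h₄ hU hV) _ _))
        (m _ (mul_mem_evenSpan h₂ h₄ hU hV') _ _)
    · rw [polar_comm, polar_C]; exact zero_mem _
  · rw [polar_C]; exact zero_mem _

/-- At `h = 0` every chain vanishes, leaving only the coefficients from `S`. -/
lemma mem_of_C_mem_adjoin_chainSet {a : A} (ha : C a ∈ Algebra.adjoin F (chainSet S Y)) :
    a ∈ S := by
  have key : ∀ P ∈ Algebra.adjoin F (chainSet S Y),
      evalMat (0 : Matrix (Fin 2) (Fin 2) F) P ∈ S := by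
    intro P hP
    have : Algebra.adjoin F (chainSet S Y) ≤
        S.comap ((evalMat (0 : Matrix (Fin 2) (Fin 2) F)).restrictScalars F) := by
      refine Algebra.adjoin_le ?_
      rintro _ (⟨U, hU, i, j, rfl⟩ | ⟨b, hb, rfl⟩)
      · simp [evalMat, chain]
      · simpa [evalMat] using hb
    exact this hP
  simpa [evalMat_C] using key _ ha

end Words

/-! ### The Omega process applied to semi-invariants, left action and then right action -/

section SemiInvariants

variable {F : Type*} [Field F] {m : ℕ}

/-- The substitution `X_k ↦ hᵀ X_k` with `h` the generic matrix. -/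
noncomputable def leftSub (F : Type*) [Field F] (m : ℕ) :
    CoordRing F 2 m →ₐ[F] MatPoly (CoordRing F 2 m) :=
  aeval fun p => X (0, p.2.1) * C (X (p.1, 0, p.2.2)) + X (1, p.2.1) * C (X (p.1, 1, p.2.2))

/-- The substitution `X_k ↦ X_k h` with `h` the generic matrix. -/
noncomputable def rightSub (F : Type*) [Field F] (m : ℕ) :
    CoordRing F 2 m →ₐ[F] MatPoly (CoordRing F 2 m) :=
  aeval fun p => C (X (p.1, p.2.1, 0)) * X (0, p.2.2) + C (X (p.1, p.2.1, 1)) * X (1, p.2.2)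

lemma evalMat_leftSub_eq_of_mem_R {f : CoordRing F 2 m} (hf : f ∈ R F 2 m)
    (h : Matrix (Fin 2) (Fin 2) F) (s : Matrix.SpecialLinearGroup (Fin 2) F) :
    evalMat (h * s.1) (leftSub F m f) = evalMat h (leftSub F m f) := by
  -- Because `leftSub` uses `hᵀ`, replacing `h` by `h s` amounts to acting first by `sᵀ`, again in
  -- `SL₂`.
  have key : ((evalMat (h * s.1)).restrictScalars F).comp (leftSub F m) =
      (((evalMat h).restrictScalars F).comp (leftSub F m)).comp (subst m s.transpose 1) := by
    apply MvPolynomial.algHom_ext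
    rintro ⟨k, i, j⟩
    fin_cases j <;> simp [evalMat, leftSub, subst, constMatrix, genericMatrix, Matrix.mul_apply,
      Fin.sum_univ_two, MvPolynomial.algebraMap_eq] <;> ring
  have := DFunLike.congr_fun key f
  simp only [AlgHom.comp_apply, AlgHom.restrictScalars_apply] at this
  rw [this, hf]

lemma evalMat_rightSub_eq_of_mem_R {f : CoordRing F 2 m} (hf : f ∈ R F 2 m)
    (h : Matrix (Fin 2) (Fin 2) F) (s : Matrix.SpecialLinearGroup (Fin 2) F) :
    evalMat (h * s.1) (rightSub F m f) = evalMat h (rightSub F m f) := by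
  -- `subst` inverts its second matrix, so `s⁻¹` produces right multiplication by `s`.
  have key : ((evalMat (h * s.1)).restrictScalars F).comp (rightSub F m) =
      (((evalMat h).restrictScalars F).comp (rightSub F m)).comp (subst m 1 s⁻¹) := by
    apply MvPolynomial.algHom_ext
    rintro ⟨k, i, j⟩
    fin_cases i <;> simp only [subst, inv_inv] <;>
    simp [evalMat, rightSub, constMatrix, genericMatrix, Matrix.mul_apply,
      Fin.sum_univ_two, MvPolynomial.algebraMap_eq] <;> ring
  have := DFunLike.congr_fun key f
  simp only [AlgHom.comp_apply, AlgHom.restrictScalars_apply] at this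
  rw [this, hf]

lemma aeval_C_mul_X_of_isHomogeneous {σ : Type*} {f : MvPolynomial σ F} {n : ℕ}
    (hf : f.IsHomogeneous n) (t : F) :
    aeval (fun p => C t * X p : σ → MvPolynomial σ F) f = C (t ^ n) * f := by
  conv_lhs => rw [f.as_sum]
  conv_rhs => rw [f.as_sum]
  rw [map_sum, Finset.mul_sum]
  refine Finset.sum_congr rfl fun d hd => ?_
  have hdeg := hf.degree_eq_sum_deg_support hd
  rw [aeval_monomial, monomial_eq, hdeg]
  simp only [Finsupp.prod, mul_pow, Finset.prod_mul_distrib, Finset.prod_pow_eq_pow_sum,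
    MvPolynomial.algebraMap_eq, map_pow]
  ring

lemma evalMat_smul_one_leftSub {f : CoordRing F 2 m} {n : ℕ} (hf : f.IsHomogeneous n) (t : F) :
    evalMat (t • (1 : Matrix (Fin 2) (Fin 2) F)) (leftSub F m f) =
      algebraMap F (CoordRing F 2 m) (t ^ n) * f := by
  have key : ((evalMat (t • (1 : Matrix (Fin 2) (Fin 2) F))).restrictScalars F).comp (leftSub F m) =
      aeval (fun p => C t * X p) := by
    apply MvPolynomial.algHom_ext
    rintro ⟨k, i, j⟩
    fin_cases i <;> simp [evalMat, leftSub, MvPolynomial.algebraMap_eq]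
  rw [MvPolynomial.algebraMap_eq, ← aeval_C_mul_X_of_isHomogeneous hf, ← key]
  rfl

lemma evalMat_smul_one_rightSub {f : CoordRing F 2 m} {n : ℕ} (hf : f.IsHomogeneous n) (t : F) :
    evalMat (t • (1 : Matrix (Fin 2) (Fin 2) F)) (rightSub F m f) =
      algebraMap F (CoordRing F 2 m) (t ^ n) * f := by
  have key : ((evalMat (t • (1 : Matrix (Fin 2) (Fin 2) F))).restrictScalars F).comp (rightSub F m)
      = aeval (fun p => C t * X p) := by
    apply MvPolynomial.algHom_ext
    rintro ⟨k, i, j⟩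
    fin_cases j <;> simp [evalMat, rightSub, MvPolynomial.algebraMap_eq, mul_comm]
  rw [MvPolynomial.algebraMap_eq, ← aeval_C_mul_X_of_isHomogeneous hf, ← key]
  rfl

/-- The determinant of the `q`-th column of `X_k` and the `q'`-th column of `X_l`. -/
noncomputable def bracket (F : Type*) [Field F] {m : ℕ} (p p' : Fin m × Fin 2) : CoordRing F 2 m :=
  X (p.1, 0, p.2) * X (p'.1, 1, p'.2) - X (p.1, 1, p.2) * X (p'.1, 0, p'.2)

/-- The set of all brackets. -/
def bracketSet (F : Type*) [Field F] (m : ℕ) : Set (CoordRing F 2 m) :=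
  Set.range fun p : (Fin m × Fin 2) × (Fin m × Fin 2) => bracket F p.1 p.2

/-- First fundamental theorem for the left action: semi-invariants are polynomials in brackets. -/
lemma mem_adjoin_bracketSet [CharZero F] {f : CoordRing F 2 m} (hf : f ∈ R F 2 m) {n : ℕ}
    (hn : f.IsHomogeneous n) : f ∈ Algebra.adjoin F (bracketSet F m) := by
  let y : Fin 2 → Fin m × Fin 2 → MatPoly (CoordRing F 2 m) := fun i p =>
    X (0, i) * C (X (p.1, 0, p.2)) + X (1, i) * C (X (p.1, 1, p.2))
  let G : Set (MatPoly (CoordRing F 2 m)) := {P | ∃ i p, P = y i p} ∪ C '' bracketSet F m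
  have hG : ∀ g ∈ G, cayley g ∈ Algebra.adjoin F G := by
    rintro _ (⟨i, p, rfl⟩ | ⟨b, -, rfl⟩)
    · have : cayley (y i p) = 0 := by
        fin_cases i <;> simp [cayley, y, pderiv_X, Derivation.leibniz]
      rw [this]; exact zero_mem _
    · rw [cayley_C]; exact zero_mem _
  have hG₂ : ∀ g ∈ G, ∀ g' ∈ G, polar g g' ∈ Algebra.adjoin F G := by
    rintro _ (⟨i, p, rfl⟩ | ⟨b, -, rfl⟩) g' hg'
    · rcases hg' with ⟨j, p', rfl⟩ | ⟨b, -, rfl⟩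
      · have : polar (y i p) (y j p') = (alt i j : MatPoly (CoordRing F 2 m)) *
            C (bracket F p p') := by
          fin_cases i <;> fin_cases j <;>
            simp [polar, y, alt, bracket, pderiv_X, Derivation.leibniz]
        rw [this]
        exact mul_mem (intCast_mem _ _)
          (Algebra.subset_adjoin (Or.inr ⟨_, ⟨(p, p'), rfl⟩, rfl⟩))
      · rw [polar_comm, polar_C]; exact zero_mem _
    · rw [polar_C]; exact zero_mem _
  have hP : leftSub F m f ∈ Algebra.adjoin F G := by
    have h1 : leftSub F m f ∈ (leftSub F m).range := ⟨f, rfl⟩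
    rw [leftSub, ← Algebra.adjoin_range_eq_range_aeval] at h1
    refine Algebra.adjoin_mono ?_ h1
    rintro _ ⟨⟨k, i, j⟩, rfl⟩
    exact Or.inl ⟨i, (k, j), rfl⟩
  have hC := C_mem_of_invariant hG hG₂ hP f n (evalMat_leftSub_eq_of_mem_R hf)
    (evalMat_smul_one_leftSub hn)
  -- Setting `h = 0` kills the linear forms `y i p` and leaves the brackets.
  have key : Algebra.adjoin F G ≤ (Algebra.adjoin F (bracketSet F m)).comap
      ((evalMat (0 : Matrix (Fin 2) (Fin 2) F)).restrictScalars F) := by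
    refine Algebra.adjoin_le ?_
    rintro _ (⟨i, p, rfl⟩ | ⟨b, hb, rfl⟩)
    · simp [evalMat, y]
    · simpa [evalMat] using Algebra.subset_adjoin hb
  simpa [evalMat_C] using key hC

lemma rightSub_bracket (p p' : Fin m × Fin 2) :
    rightSub F m (bracket F p p') =
      chain ((genericMatrix F 2 m p.1).adjugate * genericMatrix F 2 m p'.1) p.2 p'.2 := by
  obtain ⟨u1, u2, u3, u4⟩ := adjugate_fin_two_entries (genericMatrix F 2 m p.1)
  simp only [rightSub, bracket, chain, map_sub, map_mul, aeval_X, Matrix.mul_apply,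
    Fin.sum_univ_two, u1, u2, u3, u4, map_add, map_neg]
  simp only [genericMatrix, Matrix.of_apply]
  ring

/-- A subalgebra containing the basic traces contains all homogeneous semi-invariants. -/
lemma mem_of_trace_mem [CharZero F] (S : Subalgebra F (CoordRing F 2 m))
    (h₂ : ∀ k l, ((genericMatrix F 2 m k).adjugate * genericMatrix F 2 m l).trace ∈ S)
    (h₄ : ∀ k l p q, ((genericMatrix F 2 m k).adjugate * genericMatrix F 2 m l *
      ((genericMatrix F 2 m p).adjugate * genericMatrix F 2 m q)).trace ∈ S)
    {f : CoordRing F 2 m} (hf : f ∈ R F 2 m) {n : ℕ} (hn : f.IsHomogeneous n) : f ∈ S := by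
  have hP : rightSub F m f ∈ Algebra.adjoin F (chainSet S (genericMatrix F 2 m)) := by
    have key : Algebra.adjoin F (bracketSet F m) ≤
        (Algebra.adjoin F (chainSet S (genericMatrix F 2 m))).comap (rightSub F m) := by
      refine Algebra.adjoin_le ?_
      rintro _ ⟨⟨p, p'⟩, rfl⟩
      refine Algebra.subset_adjoin (Or.inl ⟨_, adjugate_mul_mem_evenSpan p.1 p'.1, p.2, p'.2, ?_⟩)
      exact rightSub_bracket p p'
    exact key (mem_adjoin_bracketSet hf hn)
  exact mem_of_C_mem_adjoin_chainSet (C_mem_of_invariant (cayley_mem_chainSet h₂)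
    (polar_mem_chainSet h₂ h₄) hP f n (evalMat_rightSub_eq_of_mem_R hf)
    (evalMat_smul_one_rightSub hn))

/-! ### Homogeneous components, and the invariance and degrees of the generating traces -/

lemma subst_isHomogeneous {A B : Matrix.SpecialLinearGroup (Fin 2) F} {f : CoordRing F 2 m} {n : ℕ}
    (hf : f.IsHomogeneous n) : (subst m A B f).IsHomogeneous n := by
  have := hf.aeval (n := 1) (fun p : Fin m × Fin 2 × Fin 2 =>
    (constMatrix m A * genericMatrix F 2 m p.1 * constMatrix m B⁻¹) p.2.1 p.2.2) (by
      rintro ⟨k, i, j⟩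
      simp only [Matrix.mul_apply, constMatrix, genericMatrix, Matrix.map_apply, Matrix.of_apply]
      refine IsHomogeneous.sum _ _ _ fun q _ => ?_
      rw [mul_comm]
      exact (IsHomogeneous.sum _ _ _ fun q _ => (isHomogeneous_X _ _).C_mul _).C_mul _)
  simpa [subst] using this

lemma homogeneousComponent_mem_R {f : CoordRing F 2 m} (hf : f ∈ R F 2 m) (n : ℕ) :
    homogeneousComponent n f ∈ R F 2 m := by
  intro A B
  have h1 : homogeneousComponent n (subst m A B f) =
      subst m A B (homogeneousComponent n f) := by
    conv_lhs => rw [← sum_homogeneousComponent f, map_sum, map_sum]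
    rw [Finset.sum_congr rfl fun i _ => homogeneousComponent_of_mem
      (subst_isHomogeneous (homogeneousComponent_isHomogeneous i f))]
    rw [Finset.sum_ite_eq]
    split_ifs with h
    · rfl
    · rw [homogeneousComponent_eq_zero n f (by simpa using h), map_zero]
  rw [← h1, hf A B]

lemma map_subst_genericMatrix (A B : Matrix.SpecialLinearGroup (Fin 2) F) (k : Fin m) :
    (genericMatrix F 2 m k).map (subst m A B) =
      constMatrix m A * genericMatrix F 2 m k * constMatrix m B⁻¹ := by
  ext i j
  simp [genericMatrix, subst]

lemma adjugate_constMatrix_mul (A : Matrix.SpecialLinearGroup (Fin 2) F) :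
    (constMatrix m A).adjugate * constMatrix m A = 1 := by
  rw [Matrix.adjugate_mul]
  have : (constMatrix m A).det = 1 := by
    have h := RingHom.map_det (C : F →+* CoordRing F 2 m) A.1
    rw [A.2, map_one] at h
    exact h.symm
  rw [this, one_smul]

/-- The left factor cancels through `adj(A) A = 1`, so even words are merely conjugated and their
traces are invariant. -/
lemma map_subst_adjugate_mul (A B : Matrix.SpecialLinearGroup (Fin 2) F) (k l : Fin m) :
    ((genericMatrix F 2 m k).adjugate * genericMatrix F 2 m l).map (subst m A B) =
      (constMatrix m B⁻¹).adjugate * ((genericMatrix F 2 m k).adjugate * genericMatrix F 2 m l) *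
        constMatrix m B⁻¹ := by
  have h1 : ((genericMatrix F 2 m k).adjugate * genericMatrix F 2 m l).map (subst m A B) =
      ((genericMatrix F 2 m k).map (subst m A B)).adjugate *
        (genericMatrix F 2 m l).map (subst m A B) := by
    rw [Matrix.map_mul]
    congr 1
    exact AlgHom.map_adjugate (subst m A B) _
  rw [h1, map_subst_genericMatrix, map_subst_genericMatrix, Matrix.adjugate_mul_distrib,
    Matrix.adjugate_mul_distrib]
  calc _ = (constMatrix m B⁻¹).adjugate * (genericMatrix F 2 m k).adjugate *
        ((constMatrix m A).adjugate * constMatrix m A) * genericMatrix F 2 m l *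
          constMatrix m B⁻¹ := by simp only [Matrix.mul_assoc]
    _ = _ := by rw [adjugate_constMatrix_mul]; simp only [Matrix.mul_assoc, Matrix.one_mul]

lemma constMatrix_mul_adjugate (A : Matrix.SpecialLinearGroup (Fin 2) F) :
    constMatrix m A * (constMatrix m A).adjugate = 1 :=
  mul_eq_one_comm.1 (adjugate_constMatrix_mul A)

lemma trace_map_subst (A B : Matrix.SpecialLinearGroup (Fin 2) F)
    (M : Matrix (Fin 2) (Fin 2) (CoordRing F 2 m)) :
    subst m A B M.trace = (M.map (subst m A B)).trace := by
  simp [Matrix.trace_fin_two]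

lemma trace_adjugate_mul_mem_R (k l : Fin m) :
    ((genericMatrix F 2 m k).adjugate * genericMatrix F 2 m l).trace ∈ R F 2 m := by
  intro A B
  rw [trace_map_subst, map_subst_adjugate_mul, Matrix.trace_mul_comm, ← Matrix.mul_assoc,
    constMatrix_mul_adjugate, Matrix.one_mul]

lemma trace_adjugate_mul_mul_mem_R (k l p q : Fin m) :
    ((genericMatrix F 2 m k).adjugate * genericMatrix F 2 m l *
      ((genericMatrix F 2 m p).adjugate * genericMatrix F 2 m q)).trace ∈ R F 2 m := by
  intro A B
  rw [trace_map_subst, Matrix.map_mul, map_subst_adjugate_mul, map_subst_adjugate_mul]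
  generalize (genericMatrix F 2 m k).adjugate * genericMatrix F 2 m l = U
  generalize (genericMatrix F 2 m p).adjugate * genericMatrix F 2 m q = V
  have h := constMatrix_mul_adjugate (m := m) B⁻¹
  generalize constMatrix m B⁻¹ = T at h
  calc _ = (T.adjugate * (U * (T * T.adjugate) * V * T)).trace := by simp only [Matrix.mul_assoc]
    _ = (U * V * (T * T.adjugate)).trace := by
      rw [h, Matrix.trace_mul_comm]; simp only [Matrix.mul_assoc, h, Matrix.mul_one]
    _ = _ := by rw [h, Matrix.mul_one]

lemma isHomogeneous_mul_apply {M N : Matrix (Fin 2) (Fin 2) (CoordRing F 2 m)} {a b : ℕ}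
    (hM : ∀ i j, (M i j).IsHomogeneous a) (hN : ∀ i j, (N i j).IsHomogeneous b) (i j : Fin 2) :
    ((M * N) i j).IsHomogeneous (a + b) := by
  rw [Matrix.mul_apply]
  exact IsHomogeneous.sum _ _ _ fun q _ => (hM i q).mul (hN q j)

lemma isHomogeneous_adjugate_mul_apply (k l : Fin m) (i j : Fin 2) :
    (((genericMatrix F 2 m k).adjugate * genericMatrix F 2 m l) i j).IsHomogeneous 2 := by
  have hX : ∀ k i j, (genericMatrix F 2 m k i j).IsHomogeneous 1 := fun k i j =>
    isHomogeneous_X _ _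
  refine isHomogeneous_mul_apply (a := 1) (b := 1) (fun i j => ?_) (hX l) i j
  obtain ⟨u1, u2, u3, u4⟩ := adjugate_fin_two_entries (genericMatrix F 2 m k)
  fin_cases i <;> fin_cases j
  · exact u1 ▸ hX _ _ _
  · exact u2 ▸ (hX _ _ _).neg
  · exact u3 ▸ (hX _ _ _).neg
  · exact u4 ▸ hX _ _ _

lemma isHomogeneous_trace {M : Matrix (Fin 2) (Fin 2) (CoordRing F 2 m)} {a : ℕ}
    (hM : ∀ i j, (M i j).IsHomogeneous a) : M.trace.IsHomogeneous a :=
  IsHomogeneous.sum _ _ _ fun i _ => hM i i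

theorem generatedInDegreeLE_two_four (F : Type*) [Field F] [CharZero F] (m : ℕ) :
    GeneratedInDegreeLE F 2 m 4 := by
  refine le_antisymm (Algebra.adjoin_le fun f hf => hf.1) fun f hf => ?_
  rw [← sum_homogeneousComponent f]
  refine sum_mem fun n _ => mem_of_trace_mem
    (Algebra.adjoin F {f : CoordRing F 2 m | f ∈ R F 2 m ∧ f.totalDegree ≤ 4}) (fun k l => Algebra.subset_adjoin ⟨?_, ?_⟩)
    (fun k l p q => Algebra.subset_adjoin ⟨?_, ?_⟩) (homogeneousComponent_mem_R hf n)
    (homogeneousComponent_isHomogeneous n f)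
  · exact trace_adjugate_mul_mem_R k l
  · exact (isHomogeneous_trace (isHomogeneous_adjugate_mul_apply k l)).totalDegree_le.trans
      (by norm_num)
  · exact trace_adjugate_mul_mul_mem_R k l p q
  · exact (isHomogeneous_trace (isHomogeneous_mul_apply (isHomogeneous_adjugate_mul_apply k l)
      (isHomogeneous_adjugate_mul_apply p q))).totalDegree_le

end SemiInvariants

end MatrixSemiInvariants

theorem mainTheorem2 (F : Type*) [Field F] [CharZero F] (m : ℕ) :
    MatrixSemiInvariants.GeneratedInDegreeLE F 2 m 4 ∧ MatrixSemiInvariants.beta F 2 m ≤ 4 :=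
  ⟨MatrixSemiInvariants.generatedInDegreeLE_two_four F m,
    sInf_le ⟨4, MatrixSemiInvariants.generatedInDegreeLE_two_four F m, rfl⟩⟩
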